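/- A monotone triangle with $n$ rows is a triangular array $(a_{i,j})_{1\le j\le i\le n}$ of integers such that $a_{i,j}\le a_{i-1,j}\le a_{i,j+1}$ and $a_{i,j}<a_{i,j+1}$ whenever these entries are defined; its bottom row is $(a_{n,1},\dots,a_{n,n})$. For integers $k_1<k_2<\dots<k_n$, the number of monotone triangles with $n$ rows and bottom row $(k_1,\dots,k_n)$ is finite and equal to $$\left.\left[\left(\prod_{1\le p<q\le n}\bigl(\operatorname{id}+E_{x_p}\Delta_{x_q}\bigr)\right)\prod_{1\le i<j\le n}\frac{x_j-x_i}{j-i}\right]\right|_{(x_1,\dots,x_n)=(k_1,\dots,k_n)},$$ where $E_{x}$ is the shift operator on polynomials, defined by $E_x\,p(x)=p(x+1)$ (the other variables being unchanged), $\Delta_x=E_x-\operatorname{id}$ is the difference operator, and the product of operators is their composition (the factors commute, so the order does not matter). -/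

import Mathlib

/-- A monotone triangle with `n` rows: a triangular array of integers whose row number `i`
(counted from `0`, from top to bottom) has `i + 1` entries, which is strictly increasing along
rows and weakly increasing in northeast and in southeast direction. -/
@[ext]
structure MonotoneTriangle (n : ℕ) where
  /-- `entry i j` is the `j`-th entry of the `i`-th row (both counted from `0`). -/
  entry : (i : Fin n) → Fin ((i : ℕ) + 1) → ℤ
  row_lt : ∀ (i : Fin n) (j : Fin (i : ℕ)), entry i j.castSucc < entry i j.succ
  northeast : ∀ (i : ℕ) (h : i + 1 < n) (j : Fin (i + 1)),
    entry ⟨i + 1, h⟩ j.castSucc ≤ entry ⟨i, Nat.lt_of_succ_lt h⟩ j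
  southeast : ∀ (i : ℕ) (h : i + 1 < n) (j : Fin (i + 1)),
    entry ⟨i, Nat.lt_of_succ_lt h⟩ j ≤ entry ⟨i + 1, h⟩ j.succ

/-- The set of monotone triangles with `n` rows whose bottom row (the row with `n` entries)
is `k`. -/
def monotoneTriangles (n : ℕ) (k : Fin n → ℤ) : Set (MonotoneTriangle n) :=
  {T | ∀ (i : Fin n) (h : (i : ℕ) + 1 = n) (j : Fin ((i : ℕ) + 1)),
    T.entry i j = k (Fin.cast h j)}

/-- The shift operator `E_{x_i}` on `ℚ[x_1, …, x_n]`: it replaces the variable `x_i` by `x_i + 1`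
and leaves the other variables unchanged. -/
noncomputable def shiftOp {n : ℕ} (i : Fin n) : Module.End ℚ (MvPolynomial (Fin n) ℚ) :=
  (MvPolynomial.aeval
    (fun j : Fin n => if j = i then MvPolynomial.X j + 1 else MvPolynomial.X j) :
      MvPolynomial (Fin n) ℚ →ₐ[ℚ] MvPolynomial (Fin n) ℚ).toLinearMap

/-- The difference operator `Δ_{x_i} = E_{x_i} - id`. -/
noncomputable def diffOp {n : ℕ} (i : Fin n) : Module.End ℚ (MvPolynomial (Fin n) ℚ) :=
  shiftOp i - 1

theorem shiftOp_commute {n : ℕ} (i j : Fin n) : Commute (shiftOp i) (shiftOp j) := by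
  unfold shiftOp Commute SemiconjBy
  rw [Module.End.mul_eq_comp, Module.End.mul_eq_comp, ← AlgHom.comp_toLinearMap,
    ← AlgHom.comp_toLinearMap]
  congr 1
  apply MvPolynomial.algHom_ext
  intro l
  by_cases h1 : l = i <;> by_cases h2 : l = j <;> simp [h1, h2] <;> split_ifs <;> simp_all

/-- The operator `id + E_{x_p} Δ_{x_q}`; the product of operators is the composition. -/
noncomputable def factorOp {n : ℕ} (p q : Fin n) : Module.End ℚ (MvPolynomial (Fin n) ℚ) :=
  1 + shiftOp p * diffOp q

theorem factorOp_commute {n : ℕ} (p q r s : Fin n) :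
    Commute (factorOp p q) (factorOp r s) := by
  have hd : ∀ i j : Fin n, Commute (shiftOp i) (diffOp j) := fun i j =>
    (shiftOp_commute i j).sub_right (Commute.one_right _)
  have hdd : Commute (diffOp q) (diffOp s) := (hd q s).sub_left (Commute.one_left _)
  have h : Commute (shiftOp p * diffOp q) (shiftOp r * diffOp s) :=
    ((shiftOp_commute p r).mul_right (hd p s)).mul_left
      ((hd r q).symm.mul_right hdd)
  exact (Commute.one_left _).add_left ((Commute.one_right _).add_right h)

/-- The index pairs `(p, q)` with `p < q`. -/
def indexPairs (n : ℕ) : Finset (Fin n × Fin n) :=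
  Finset.univ.filter (fun e => e.1 < e.2)

/-- The operator `∏_{p < q} (id + E_{x_p} Δ_{x_q})`. The factors commute, so their composition
does not depend on the order. -/
noncomputable def productOp (n : ℕ) : Module.End ℚ (MvPolynomial (Fin n) ℚ) :=
  (indexPairs n).noncommProd (fun e => factorOp e.1 e.2)
    (fun a _ b _ _ => factorOp_commute a.1 a.2 b.1 b.2)

/-- The polynomial `∏_{i < j} (x_j - x_i) / (j - i)` in `ℚ[x_1, …, x_n]`. -/
noncomputable def vandermondeQuotient (n : ℕ) : MvPolynomial (Fin n) ℚ :=
  ∏ e ∈ indexPairs n,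
    MvPolynomial.C (1 / (((e.2 : ℕ) : ℚ) - ((e.1 : ℕ) : ℚ))) *
      (MvPolynomial.X e.2 - MvPolynomial.X e.1)

/-!
Polynomials in the shift operators are elements of the group ring `ℤ[ℤ^n]` acting on functions on
`ℤ^n`. The Vandermonde quotient is the determinant of the binomial coefficients `x_i` over `j`, and
applying all the difference operators `Δ_i` to the determinant with the lower indices raised by one
gives it back. Let `G` be the product of the operators `1 + E_p Δ_q`, `p < q`, applied to the raised
determinant. By antisymmetry, `(1 + E_{i+1} Δ_i) G` vanishes where `x_i = x_{i+1}`. Hence the sum of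
`Δ_1 ⋯ Δ_m G` over the rows that interlace `(k_0, …, k_m)` strictly telescopes to
`∑_j (-1)^j G(k_0, …, k_{j-1}, k_{j+1} + 1, …, k_m + 1)`. This is the expansion along the first
column of the determinant of size `m + 1`: on a function that does not depend on `x_j`, the operator
`1 + E_p Δ_j` acts as the identity and `1 + E_j Δ_q` acts as `E_q`. So the formula satisfies the
recursion that counts monotone triangles by the row above the bottom row.
-/

open AddMonoidAlgebra Matrix

/-! ### The group ring of shifts -/

section Shifts

variable {A B M N : Type*} [AddCommMonoid A] [AddCommMonoid B] [AddCommGroup M] [AddCommGroup N]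

/-- The translation action of `ℤ[A]` on functions on `A`: the basis element of `v : A` sends `f` to
`f (· + v)`. It makes polynomials in the shift operators elements of a commutative ring, so that
their products need no ordering. -/
noncomputable def shiftAction (A M : Type*) [AddCommMonoid A] [AddCommGroup M] :
    ℤ[A] →ₐ[ℤ] Module.End ℤ (A → M) :=
  AddMonoidAlgebra.lift ℤ _ A
    { toFun v := LinearMap.funLeft ℤ M (· + v.toAdd)
      map_one' := by ext; simp
      map_mul' v w := by ext; simp [add_assoc] }

theorem shiftAction_single (v : A) (c : ℤ) (f : A → M) (x : A) :
    shiftAction A M (single v c) f x = c • f (x + v) := by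
  simp [shiftAction]

theorem shiftAction_mul_apply (r s : ℤ[A]) (f : A → M) :
    shiftAction A M (r * s) f = shiftAction A M r (shiftAction A M s f) := by
  rw [map_mul, Module.End.mul_apply]

theorem shiftAction_comp_right {φ : A →+ B} {θ : A → B} (hθ : ∀ x v, θ (x + v) = θ x + φ v)
    (r : ℤ[A]) (f : B → M) :
    shiftAction A M r (f ∘ θ) = shiftAction B M (mapDomainRingHom ℤ φ r) f ∘ θ := by
  ext x
  induction r using AddMonoidAlgebra.induction_linear with
  | zero => simp
  | add r s hr hs =>
    simp only [map_add, LinearMap.add_apply, Pi.add_apply, Function.comp_apply] at hr hs ⊢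
    rw [hr, hs]
  | single v c => simp [shiftAction_single, hθ]

theorem shiftAction_comp_left (g : M →+ N) (r : ℤ[A]) (f : A → M) :
    shiftAction A N r (g ∘ f) = g ∘ shiftAction A M r f := by
  ext x
  induction r using AddMonoidAlgebra.induction_linear with
  | zero => simp
  | add r s hr hs => simpa using congrArg₂ (· + ·) hr hs
  | single v c => simp [shiftAction_single]

end Shifts

section CoordinateShifts

variable {ι κ M : Type*} [DecidableEq ι] [DecidableEq κ] [AddCommGroup M]

/-- The shift `E_i` as an element of `ℤ[ℤ^ι]`. -/
noncomputable def shiftVar (i : ι) : ℤ[ι → ℤ] :=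
  single (Pi.single i 1) 1

/-- The factor `1 + E_p Δ_q` as an element of `ℤ[ℤ^ι]`. -/
noncomputable def shiftFactor (p q : ι) : ℤ[ι → ℤ] :=
  1 + shiftVar p * (shiftVar q - 1)

theorem shiftAction_shiftVar (i : ι) (f : (ι → ℤ) → M) (x : ι → ℤ) :
    shiftAction _ M (shiftVar i) f x = f (x + Pi.single i 1) := by
  rw [shiftVar, shiftAction_single, one_smul]

theorem shiftAction_shiftVar_sub_one (i : ι) (f : (ι → ℤ) → M) (x : ι → ℤ) :
    shiftAction _ M (shiftVar i - 1) f x = f (x + Pi.single i 1) - f x := by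
  simp [shiftAction_shiftVar]

theorem shiftAction_shiftFactor (p q : ι) (f : (ι → ℤ) → M) (x : ι → ℤ) :
    shiftAction _ M (shiftFactor p q) f x =
      f x + (f (x + Pi.single p 1 + Pi.single q 1) - f (x + Pi.single p 1)) := by
  simp [shiftFactor, shiftAction_shiftVar]

theorem shiftAction_prod_shiftVar (s : Finset ι) (f : (ι → ℤ) → M) (x : ι → ℤ) :
    shiftAction _ M (∏ i ∈ s, shiftVar i) f x = f (x + ∑ i ∈ s, Pi.single i 1) := by
  induction s using Finset.induction_on generalizing x with
  | empty => simp
  | insert a s ha ih =>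
    rw [Finset.prod_insert ha, Finset.sum_insert ha, shiftAction_mul_apply, shiftAction_shiftVar,
      ih, add_assoc]

theorem mapDomainRingHom_shiftVar {i : ι} {j : κ} {φ : (ι → ℤ) →+ (κ → ℤ)}
    (h : φ (Pi.single i 1) = Pi.single j 1) :
    mapDomainRingHom ℤ φ (shiftVar i) = shiftVar j := by
  simp [shiftVar, h]

theorem shiftAction_prod_sub_one_multilinear {V : ι → Type*} [∀ i, AddCommGroup (V i)]
    (F : MultilinearMap ℤ V M) (b : ∀ i, ℤ → V i) (s : Finset ι) (x : ι → ℤ) :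
    shiftAction _ M (∏ i ∈ s, (shiftVar i - 1)) (fun y => F fun i => b i (y i)) x =
      F (s.piecewise (fun i => b i (x i + 1) - b i (x i)) fun i => b i (x i)) := by
  induction s using Finset.induction_on generalizing x with
  | empty => simp
  | insert a s ha ih =>
    rw [Finset.prod_insert ha, shiftAction_mul_apply, shiftAction_shiftVar_sub_one, ih, ih,
      Finset.piecewise_insert, F.map_update_sub]
    congr 2 <;> ext i <;> obtain rfl | hi := eq_or_ne i a <;>
      simp [Finset.piecewise, *]

end CoordinateShifts

section Reindex

variable {ι κ M : Type*} [AddCommGroup M]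

/-- The ring homomorphism `ℤ[ℤ^ι] → ℤ[ℤ^κ]` induced by `x ↦ x ∘ f`. It sends `E_i` to the product of
the `E_j` with `f j = i`. -/
noncomputable def reindexShifts (f : κ → ι) : ℤ[ι → ℤ] →+* ℤ[κ → ℤ] :=
  mapDomainRingHom ℤ (LinearMap.funLeft ℤ ℤ f).toAddMonoidHom

theorem shiftAction_reindexShifts (f : κ → ι) (r : ℤ[ι → ℤ]) (G : (κ → ℤ) → M) (x : ι → ℤ) :
    shiftAction _ M (reindexShifts f r) G (x ∘ f) = shiftAction _ M r (fun y => G (y ∘ f)) x :=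
  (congrFun (shiftAction_comp_right (θ := (· ∘ f)) (fun _ _ => rfl) r G) x).symm

theorem shiftAction_eq_zero_of_antisymm {σ : Equiv.Perm ι}
    {r : ℤ[ι → ℤ]} (hr : reindexShifts σ r = r) {F : (ι → ℤ) → ℤ}
    (hF : ∀ y, F (y ∘ σ) = -F y) {x : ι → ℤ} (hx : x ∘ σ = x) : shiftAction _ ℤ r F x = 0 := by
  have h := shiftAction_reindexShifts σ r F x
  rw [hr, hx, show (fun y => F (y ∘ σ)) = -F from funext hF, map_neg] at h
  exact self_eq_neg.1 h

variable [DecidableEq ι]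

theorem reindexShifts_shiftVar_of_injective [DecidableEq κ] {f : κ → ι} (hf : f.Injective) (j : κ) :
    reindexShifts f (shiftVar (f j)) = shiftVar j :=
  mapDomainRingHom_shiftVar <| funext fun k => by
    simp [LinearMap.funLeft_apply, Pi.single_apply, hf.eq_iff]

theorem reindexShifts_shiftVar_of_notMem_range {f : κ → ι} {i : ι} (hi : i ∉ Set.range f) :
    reindexShifts f (shiftVar i) = 1 := by
  have hzero : LinearMap.funLeft ℤ ℤ f (Pi.single i 1) = 0 := funext fun k => by
    simpa [LinearMap.funLeft_apply, Pi.single_apply] using fun h => hi ⟨k, h⟩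
  simp [reindexShifts, shiftVar, hzero, one_def]

theorem reindexShifts_shiftFactor (f : κ → ι) (p q : ι) :
    reindexShifts f (shiftFactor p q) =
      1 + reindexShifts f (shiftVar p) * (reindexShifts f (shiftVar q) - 1) := by
  simp only [shiftFactor, map_add, map_mul, map_sub, map_one]

end Reindex

/-! ### Determinants of binomial coefficients -/

section ChooseDet

variable {m : ℕ}

/-- The determinant of the binomial coefficients `x_i` over `j + s`, an antisymmetric function of
`x`. The shift `s` is lowered by one when the difference operators of all variables are applied. -/
noncomputable def chooseDet (s m : ℕ) (x : Fin m → ℤ) : ℤ :=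
  (of fun i j : Fin m => Ring.choose (x i) (j + s)).det

theorem chooseDet_comp_perm (s : ℕ) (σ : Equiv.Perm (Fin m)) (x : Fin m → ℤ) :
    chooseDet s m (x ∘ σ) = σ.sign * chooseDet s m x :=
  det_permute σ (of fun i j : Fin m => Ring.choose (x i) (j + s))

theorem chooseDet_zero_succ (x : Fin (m + 1) → ℤ) :
    chooseDet 0 (m + 1) x =
      ∑ j : Fin (m + 1), (-1) ^ (j : ℕ) * chooseDet 1 m (x ∘ j.succAbove) := by
  rw [chooseDet, det_succ_column_zero]
  refine Finset.sum_congr rfl fun j _ => ?_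
  simp [chooseDet, submatrix]

theorem shiftAction_prod_sub_one_chooseDet (s : ℕ) :
    shiftAction _ ℤ (∏ i : Fin m, (shiftVar i - 1)) (chooseDet (s + 1) m) = chooseDet s m := by
  ext x
  refine (shiftAction_prod_sub_one_multilinear (detRowAlternating (n := Fin m)).toMultilinearMap
    (fun _ y j => Ring.choose y (j + (s + 1))) Finset.univ x).trans ?_
  rw [Finset.piecewise_univ]
  exact congrArg det <| Matrix.ext fun i j =>
    sub_eq_of_eq_add (Ring.choose_succ_succ (x i) (j + s))

theorem prod_factorial_mul_chooseDet_zero (x : Fin m → ℤ) :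
    (∏ j : Fin m, ((j : ℕ).factorial : ℤ)) * chooseDet 0 m x = (vandermonde x).det := by
  rw [chooseDet, ← det_mul_row, det_eval_matrixOfPolynomials_eq_det_vandermonde x
    (fun j => descPochhammer ℤ j) (fun j => descPochhammer_natDegree ℤ j)
    (fun j => monic_descPochhammer ℤ j)]
  congr 1
  ext i j
  simpa [← Polynomial.eval_eq_smeval] using
    (Ring.descPochhammer_eq_factorial_smul_choose (x i) j).symm

theorem chooseDet_zero_natCast : chooseDet 0 m (fun i => (i : ℤ)) = 1 := by
  rw [chooseDet, det_of_isLowerTriangular]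
  · simp [Ring.choose_natCast]
  · intro i j hij
    have : (i : ℕ) < j := hij
    simp [Ring.choose_natCast, Nat.choose_eq_zero_of_lt this]

theorem prod_indexPairs {M : Type*} [CommMonoid M] (f : Fin m → Fin m → M) :
    ∏ e ∈ indexPairs m, f e.1 e.2 = ∏ p, ∏ q, if p < q then f p q else 1 := by
  rw [indexPairs, Finset.prod_filter, ← Finset.univ_product_univ, Finset.prod_product]

theorem det_vandermonde_eq_prod_indexPairs {R : Type*} [CommRing R] (x : Fin m → R) :
    (vandermonde x).det = ∏ e ∈ indexPairs m, (x e.2 - x e.1) := by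
  rw [det_vandermonde, prod_indexPairs fun p q => x q - x p]
  exact Finset.prod_congr rfl fun p _ => by rw [← Finset.prod_filter, Finset.filter_lt_eq_Ioi]

theorem eval_vandermondeQuotient (x : Fin m → ℤ) :
    MvPolynomial.eval (fun i => (x i : ℚ)) (vandermondeQuotient m) = chooseDet 0 m x := by
  have hfact : (∏ j : Fin m, ((j : ℕ).factorial : ℚ)) ≠ 0 :=
    Finset.prod_ne_zero_iff.2 fun j _ => Nat.cast_ne_zero.2 (Nat.factorial_ne_zero _)
  have hdet (y : Fin m → ℤ) : (∏ j : Fin m, ((j : ℕ).factorial : ℚ)) * chooseDet 0 m y =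
      ∏ e ∈ indexPairs m, ((y e.2 : ℚ) - y e.1) := by
    exact_mod_cast (prod_factorial_mul_chooseDet_zero y).trans
      (det_vandermonde_eq_prod_indexPairs y)
  have hfact_eq : ∏ j : Fin m, ((j : ℕ).factorial : ℚ) =
      ∏ e ∈ indexPairs m, (((e.2 : ℕ) : ℚ) - ((e.1 : ℕ) : ℚ)) := by
    simpa [chooseDet_zero_natCast] using hdet fun i => (i : ℤ)
  simp only [vandermondeQuotient, map_prod, map_mul, map_sub, MvPolynomial.eval_C,
    MvPolynomial.eval_X]
  rw [Finset.prod_mul_distrib, ← hdet, Finset.prod_div_distrib, ← hfact_eq, Finset.prod_const_one,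
    one_div, inv_mul_cancel_left₀ hfact]

end ChooseDet

/-! ### The product of the shift factors -/

section ShiftProduct

variable {n : ℕ}

/-- The operator `∏_{p < q} (1 + E_p Δ_q)` as an element of `ℤ[ℤ^n]`. -/
noncomputable def shiftProduct (n : ℕ) : ℤ[Fin n → ℤ] :=
  ∏ e ∈ indexPairs n, shiftFactor e.1 e.2

/-- The values of a polynomial at the points of the lattice `ℤ^n`, the link between operators on
polynomials and the action of `ℤ[ℤ^n]`. -/
noncomputable def latticeEval (n : ℕ) : MvPolynomial (Fin n) ℚ →ₗ[ℚ] (Fin n → ℤ) → ℚ :=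
  LinearMap.pi fun x => (MvPolynomial.aeval fun i => (x i : ℚ)).toLinearMap

theorem latticeEval_apply (P : MvPolynomial (Fin n) ℚ) (x : Fin n → ℤ) :
    latticeEval n P x = MvPolynomial.eval (fun i => (x i : ℚ)) P :=
  MvPolynomial.aeval_eq_eval (fun i => (x i : ℚ)) ▸ rfl

theorem latticeEval_shiftOp (i : Fin n) (P : MvPolynomial (Fin n) ℚ) :
    latticeEval n (shiftOp i P) = shiftAction _ ℚ (shiftVar i) (latticeEval n P) := by
  ext x
  rw [shiftAction_shiftVar]
  simp only [latticeEval, shiftOp, LinearMap.pi_apply, AlgHom.toLinearMap_apply,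
    MvPolynomial.comp_aeval_apply]
  congr 2
  ext j
  obtain rfl | hj := eq_or_ne j i <;> simp [*]

theorem latticeEval_factorOp (p q : Fin n) (P : MvPolynomial (Fin n) ℚ) :
    latticeEval n (factorOp p q P) = shiftAction _ ℚ (shiftFactor p q) (latticeEval n P) := by
  simp only [factorOp, diffOp, shiftFactor, LinearMap.add_apply, Module.End.mul_apply,
    LinearMap.sub_apply, Module.End.one_apply, map_add, map_sub, map_mul, map_one,
    latticeEval_shiftOp]

theorem latticeEval_productOp (P : MvPolynomial (Fin n) ℚ) :
    latticeEval n (productOp n P) = shiftAction _ ℚ (shiftProduct n) (latticeEval n P) := by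
  rw [productOp, shiftProduct]
  generalize_proofs hcomm
  revert hcomm
  induction indexPairs n using Finset.induction_on with
  | empty => simp
  | insert e s he ih =>
    intro hcomm
    rw [Finset.noncommProd_insert_of_notMem _ _ _ _ he, Module.End.mul_apply,
      latticeEval_factorOp, ih, Finset.prod_insert he, shiftAction_mul_apply]

theorem eval_productOp_vandermondeQuotient (n : ℕ) (k : Fin n → ℤ) :
    MvPolynomial.eval (fun i => (k i : ℚ)) (productOp n (vandermondeQuotient n)) =
      shiftAction _ ℤ (shiftProduct n) (chooseDet 0 n) k := by
  have hvalues : latticeEval n (vandermondeQuotient n) =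
      Int.castAddHom ℚ ∘ chooseDet 0 n := by
    ext x
    rw [latticeEval_apply, eval_vandermondeQuotient]
    rfl
  rw [← latticeEval_apply, latticeEval_productOp, hvalues, shiftAction_comp_left]
  rfl

end ShiftProduct

section ShiftProductSymmetry

variable {m : ℕ}

theorem prod_indexPairs_succAbove {R : Type*} [CommMonoid R]
    (f : Fin (m + 1) → Fin (m + 1) → R) (j : Fin (m + 1)) :
    ∏ e ∈ indexPairs (m + 1), f e.1 e.2 =
      (∏ i with j < j.succAbove i, f j (j.succAbove i)) *
        ((∏ i with j.succAbove i < j, f (j.succAbove i) j) *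
          ∏ e ∈ indexPairs m, f (j.succAbove e.1) (j.succAbove e.2)) := by
  rw [prod_indexPairs f, prod_indexPairs fun p q => f (j.succAbove p) (j.succAbove q),
    Fin.prod_univ_succAbove _ j, Fin.prod_univ_succAbove _ j, Finset.prod_filter,
    Finset.prod_filter, ← Finset.prod_mul_distrib]
  simp only [lt_irrefl, if_false, one_mul, Fin.prod_univ_succAbove _ j,
    Fin.succAbove_lt_succAbove_iff]

theorem reindexShifts_succAbove_shiftProduct (j : Fin (m + 1)) :
    reindexShifts j.succAbove (shiftProduct (m + 1)) =
      (∏ i with j < j.succAbove i, shiftVar i) * shiftProduct m := by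
  have hvar (i : Fin m) : reindexShifts j.succAbove (shiftVar (j.succAbove i)) = shiftVar i :=
    reindexShifts_shiftVar_of_injective Fin.succAbove_right_injective i
  have hone : reindexShifts j.succAbove (shiftVar j) = 1 :=
    reindexShifts_shiftVar_of_notMem_range (by simp)
  rw [shiftProduct, prod_indexPairs_succAbove shiftFactor j]
  simp only [map_mul, map_prod, reindexShifts_shiftFactor, hvar, hone, one_mul, sub_self,
    mul_zero, add_zero, add_sub_cancel, Finset.prod_const_one]
  simp only [shiftProduct, shiftFactor]

/-- The pairs `p < q` together with `(j, i)` are permuted by swapping the adjacent `i` and `j`. -/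
theorem reindexShifts_swap_shiftFactor_mul_shiftProduct {i j : Fin m} (hij : i ⋖ j) :
    reindexShifts (Equiv.swap i j) (shiftFactor j i * shiftProduct m) =
      shiftFactor j i * shiftProduct m := by
  have hnotMem : (j, i) ∉ indexPairs m := by simp [indexPairs, hij.lt.le]
  have hfactor (p q : Fin m) : reindexShifts (Equiv.swap i j) (shiftFactor p q) =
      shiftFactor (Equiv.swap i j p) (Equiv.swap i j q) := by
    have hvar (p : Fin m) :
        reindexShifts (Equiv.swap i j) (shiftVar p) = shiftVar (Equiv.swap i j p) := by
      simpa using reindexShifts_shiftVar_of_injective (Equiv.swap i j).injective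
        (Equiv.swap i j p)
    rw [reindexShifts_shiftFactor, hvar, hvar, shiftFactor]
  have hmem (e : Fin m × Fin m) : e ∈ insert (j, i) (indexPairs m) ↔
      (Equiv.swap i j e.1, Equiv.swap i j e.2) ∈ insert (j, i) (indexPairs m) := by
    have hval : (i : ℕ) + 1 = j := Nat.covBy_iff_add_one_eq.1 (Fin.covBy_iff.1 hij)
    simp only [indexPairs, Finset.mem_insert, Prod.ext_iff, Finset.mem_filter, Finset.mem_univ,
      true_and, Fin.ext_iff, Fin.lt_def, Equiv.swap_apply_def]
    split_ifs <;> omega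
  rw [shiftProduct, ← Finset.prod_insert (f := fun e => shiftFactor e.1 e.2) hnotMem, map_prod]
  exact Finset.prod_equiv ((Equiv.swap i j).prodCongr (Equiv.swap i j)) hmem
    fun e _ => hfactor e.1 e.2

end ShiftProductSymmetry

/-! ### Interlacing rows -/

section Interlacing

variable {m : ℕ}

open Classical in
/-- The rows that may stand directly above the row `k` in a monotone triangle. -/
noncomputable def interlacingRows (k : Fin (m + 1) → ℤ) : Finset (Fin m → ℤ) :=
  {l ∈ Fintype.piFinset fun i : Fin m => Finset.Icc (k i.castSucc) (k i.succ) | StrictMono l}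

theorem mem_interlacingRows {k : Fin (m + 1) → ℤ} {l : Fin m → ℤ} :
    l ∈ interlacingRows k ↔ (∀ i, k i.castSucc ≤ l i ∧ l i ≤ k i.succ) ∧ StrictMono l := by
  simp [interlacingRows]

theorem vecCons_mem_interlacingRows {c a : ℤ} {k : Fin (m + 1) → ℤ} {l : Fin m → ℤ} :
    vecCons a l ∈ interlacingRows (vecCons c k) ↔
      (c ≤ a ∧ a ≤ k 0) ∧ (∀ i, a < l i) ∧ l ∈ interlacingRows k := by
  simp only [mem_interlacingRows, vecCons, Fin.strictMono_cons, Fin.forall_fin_succ (n := m),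
    Fin.cons_zero, Fin.cons_succ, Fin.castSucc_zero, ← Fin.succ_castSucc]
  tauto

theorem le_of_mem_interlacingRows {k : Fin (m + 1) → ℤ} (hk : StrictMono k) {l : Fin m → ℤ}
    (hl : l ∈ interlacingRows k) (i : Fin m) : k 0 ≤ l i :=
  (hk.monotone (Fin.zero_le _)).trans ((mem_interlacingRows.1 hl).1 i).1

theorem interlacingRows_eq_univ (k : Fin 1 → ℤ) : interlacingRows k = Finset.univ :=
  Finset.eq_univ_of_forall fun l =>
    mem_interlacingRows.2 ⟨fun i => i.elim0, Subsingleton.strictMono l⟩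

variable {M : Type*} [AddCommMonoid M]

theorem sum_interlacingRows_vecCons (c : ℤ) (k : Fin (m + 1) → ℤ) (f : (Fin (m + 1) → ℤ) → M) :
    ∑ l ∈ interlacingRows (vecCons c k), f l =
      ∑ l ∈ interlacingRows k, ∑ a ∈ Finset.Icc c (k 0) with ∀ i, a < l i, f (vecCons a l) := by
  rw [Finset.sum_sigma']
  refine Finset.sum_bij' (fun l _ => ⟨vecTail l, vecHead l⟩) (fun p _ => vecCons p.2 p.1)
    (fun l hl => ?_) (fun p hp => ?_) (fun l _ => cons_head_tail l) (fun p _ => rfl)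
    (fun l _ => by rw [cons_head_tail])
  · rw [← cons_head_tail l, vecCons_mem_interlacingRows] at hl
    simpa [hl.1, hl.2.2] using hl.2.1
  · simp only [Finset.mem_sigma, Finset.mem_filter, Finset.mem_Icc] at hp
    exact vecCons_mem_interlacingRows.2 ⟨hp.2.1, hp.2.2, hp.1⟩

theorem sum_interlacingRows_ite_eq_head {d : ℤ} {k : Fin (m + 1) → ℤ}
    (hk : StrictMono (vecCons d k)) (f : (Fin (m + 1) → ℤ) → M) :
    ∑ l ∈ interlacingRows (vecCons d k), (if l 0 = d then f l else 0) =
      ∑ l ∈ interlacingRows k, f (vecCons d l) := by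
  obtain ⟨hdk, hk'⟩ := strictMono_vecCons.1 hk
  rw [← Finset.sum_filter]
  refine (Finset.sum_bij' (fun l _ => vecCons d l) (fun l _ => vecTail l) (fun l hl => ?_)
    (fun l hl => ?_) (fun l _ => rfl) (fun l hl => ?_) (fun l _ => rfl)).symm
  · rw [Finset.mem_filter, vecCons_mem_interlacingRows]
    exact ⟨⟨⟨le_rfl, hdk.le⟩, fun i => hdk.trans_le (le_of_mem_interlacingRows hk' hl i), hl⟩, rfl⟩
  · rw [Finset.mem_filter, ← cons_head_tail l, vecCons_mem_interlacingRows] at hl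
    exact hl.1.2.2
  · rw [← (Finset.mem_filter.1 hl).2]
    exact cons_head_tail l

/-- When the first entry ranges over all of `[c, d]`, the only rows that fail to increase strictly
are those whose first two entries are both `d`. -/
theorem sum_interlacingRows_vecCons_vecCons {c d : ℤ} {k : Fin (m + 1) → ℤ}
    (hk : StrictMono (vecCons d k)) (hcd : c ≤ d) (f : (Fin (m + 2) → ℤ) → M) :
    ∑ l ∈ interlacingRows (vecCons c (vecCons d k)), f l +
        ∑ l ∈ interlacingRows k, f (vecCons d (vecCons d l)) =
      ∑ l ∈ interlacingRows (vecCons d k), ∑ a ∈ Finset.Icc c d, f (vecCons a l) := by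
  rw [sum_interlacingRows_vecCons,
    ← sum_interlacingRows_ite_eq_head hk fun l => f (vecCons d l), ← Finset.sum_add_distrib]
  refine Finset.sum_congr rfl fun l hl => ?_
  have hdl : d ≤ l 0 := le_of_mem_interlacingRows hk hl 0
  have hhead (a : ℤ) : (∀ i, a < l i) ↔ a < l 0 :=
    ⟨fun h => h 0, fun h i => h.trans_le ((mem_interlacingRows.1 hl).2.monotone (Fin.zero_le i))⟩
  have hcollision : {a ∈ Finset.Icc c d | ¬a < l 0} = if l 0 = d then {d} else ∅ := by
    ext a
    grind
  simp only [cons_val_zero, hhead]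
  rw [← Finset.sum_filter_add_sum_filter_not (Finset.Icc c d) (· < l 0), hcollision]
  split_ifs <;> simp

end Interlacing

theorem sum_Icc_int_sub {M : Type*} [AddCommGroup M] (g : ℤ → M) {c d : ℤ} (h : c ≤ d) :
    ∑ a ∈ Finset.Icc c d, (g (a + 1) - g a) = g (d + 1) - g c := by
  induction d, h using Int.leInduction with
  | base => simp
  | succ d h ih =>
    rw [← Finset.insert_Icc_right_eq_Icc_add_one (h.trans (Int.lt_succ d).le),
      Finset.sum_insert (by simp), ih, sub_add_sub_cancel]

/-! ### Summation of differences over interlacing rows -/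

section Telescoping

variable {m : ℕ} {M : Type*} [AddCommGroup M]

/-- The ring homomorphism sending `E_i` to `E_{i+1}`. -/
noncomputable def shiftSucc (m : ℕ) : ℤ[Fin m → ℤ] →+* ℤ[Fin (m + 1) → ℤ] :=
  mapDomainRingHom ℤ (LinearMap.vecCons 0 LinearMap.id : _ →ₗ[ℤ] Fin (m + 1) → ℤ).toAddMonoidHom

theorem shiftSucc_shiftVar (i : Fin m) : shiftSucc m (shiftVar i) = shiftVar i.succ :=
  mapDomainRingHom_shiftVar <| funext <| Fin.cases (by simp) fun j => by
    simp [Pi.single_apply]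

theorem shiftAction_shiftSucc_vecCons (r : ℤ[Fin m → ℤ]) (G : (Fin (m + 1) → ℤ) → M) (c : ℤ)
    (x : Fin m → ℤ) :
    shiftAction _ M (shiftSucc m r) G (vecCons c x) =
      shiftAction _ M r (fun y => G (vecCons c y)) x :=
  (congrFun (shiftAction_comp_right (θ := vecCons c) (fun x v => by simp) r G) x).symm

/-- The operator `∏_i Δ_i` as an element of `ℤ[ℤ^m]`. -/
noncomputable def diffProduct (m : ℕ) : ℤ[Fin m → ℤ] :=
  ∏ i, (shiftVar i - 1)

theorem diffProduct_succ :
    diffProduct (m + 1) = (shiftVar 0 - 1) * shiftSucc m (diffProduct m) := by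
  simp only [diffProduct, Fin.prod_univ_succ, map_prod, map_sub, map_one, shiftSucc_shiftVar]

theorem vecCons_add_single_zero (a c : ℤ) (x : Fin m → ℤ) :
    vecCons a x + Pi.single 0 c = vecCons (a + c) x :=
  funext <| Fin.cases (by simp) fun i => by simp

theorem vecCons_add_single_succ (a c : ℤ) (x : Fin m → ℤ) (i : Fin m) :
    vecCons a x + Pi.single i.succ c = vecCons a (x + Pi.single i c) :=
  funext <| Fin.cases (by simp) fun j => by simp [Pi.single_apply]

theorem shiftAction_diffProduct_vecCons (G : (Fin (m + 1) → ℤ) → M) (a : ℤ) (l : Fin m → ℤ) :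
    shiftAction _ M (diffProduct (m + 1)) G (vecCons a l) =
      shiftAction _ M (diffProduct m) (fun y => G (vecCons (a + 1) y)) l -
        shiftAction _ M (diffProduct m) (fun y => G (vecCons a y)) l := by
  rw [diffProduct_succ, shiftAction_mul_apply, shiftAction_shiftVar_sub_one,
    vecCons_add_single_zero, shiftAction_shiftSucc_vecCons, shiftAction_shiftSucc_vecCons]

theorem sum_Icc_shiftAction_diffProduct_vecCons (G : (Fin (m + 1) → ℤ) → M) {c d : ℤ} (h : c ≤ d)
    (l : Fin m → ℤ) :
    ∑ a ∈ Finset.Icc c d, shiftAction _ M (diffProduct (m + 1)) G (vecCons a l) =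
      shiftAction _ M (diffProduct m) (fun y => G (vecCons (d + 1) y)) l -
        shiftAction _ M (diffProduct m) (fun y => G (vecCons c y)) l := by
  simp only [shiftAction_diffProduct_vecCons]
  exact sum_Icc_int_sub (fun a => shiftAction _ M (diffProduct m) (fun y => G (vecCons a y)) l) h

/-- Applying `1 + E_{i+1} Δ_i` to `G` gives a function that vanishes where the coordinates `i` and
`i + 1` agree. This is what makes sums over interlacing rows, in which equal adjacent entries are
forbidden, telescope. -/
def AdjacentVanishing (G : (Fin m → ℤ) → M) : Prop :=
  ∀ ⦃i j : Fin m⦄, i ⋖ j → ∀ x, x i = x j → shiftAction _ M (shiftFactor j i) G x = 0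

theorem AdjacentVanishing.comp_vecCons {G : (Fin (m + 1) → ℤ) → M} (hG : AdjacentVanishing G)
    (c : ℤ) : AdjacentVanishing fun y => G (vecCons c y) := by
  intro i j hij x hx
  rw [← shiftAction_shiftSucc_vecCons]
  simpa [shiftFactor, shiftSucc_shiftVar] using
    hG (i := i.succ) (j := j.succ) (by simpa using hij) (vecCons c x) (by simpa using hx)

theorem AdjacentVanishing.apply_vecCons_vecCons {G : (Fin (m + 2) → ℤ) → M}
    (hG : AdjacentVanishing G) (d : ℤ) (x : Fin m → ℤ) :
    G (vecCons d (vecCons (d + 1) x)) =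
      G (vecCons d (vecCons d x)) +
        G (vecCons (d + 1) (vecCons (d + 1) x)) := by
  have h := hG (i := 0) (j := Fin.succ 0) (by simp) (vecCons d (vecCons d x)) rfl
  rw [shiftAction_shiftFactor, vecCons_add_single_succ, vecCons_add_single_zero,
    vecCons_add_single_zero, ← add_sub_assoc, sub_eq_zero] at h
  exact h.symm

theorem AdjacentVanishing.shiftAction_diffProduct_vecCons_vecCons {G : (Fin (m + 2) → ℤ) → M}
    (hG : AdjacentVanishing G) (d : ℤ) (l : Fin m → ℤ) :
    shiftAction _ M (diffProduct (m + 2)) G (vecCons d (vecCons d l)) =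
      -shiftAction _ M (diffProduct m)
        (fun y => G (vecCons (d + 1) (vecCons d y))) l := by
  have hsplit : (fun y => G (vecCons d (vecCons (d + 1) y))) =
      (fun y => G (vecCons d (vecCons d y))) +
        fun y => G (vecCons (d + 1) (vecCons (d + 1) y)) :=
    funext (hG.apply_vecCons_vecCons d)
  simp only [shiftAction_diffProduct_vecCons, hsplit, map_add, Pi.add_apply]
  abel

/-- Delete the entry with index `j` of `k` and add `1` to all entries to its right. -/
def skipShift (j : Fin (m + 1)) (k : Fin (m + 1) → ℤ) : Fin m → ℤ :=
  fun i => if i.castSucc < j then k i.castSucc else k i.succ + 1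

theorem skipShift_zero_vecCons (c : ℤ) (k : Fin (m + 1) → ℤ) :
    skipShift 0 (vecCons c k) = k + 1 := by
  ext i
  simp [skipShift]

theorem skipShift_succ_vecCons (j : Fin (m + 1)) (c : ℤ) (k : Fin (m + 1) → ℤ) :
    skipShift j.succ (vecCons c k) = vecCons c (skipShift j k) :=
  funext <| Fin.cases (by simp [skipShift]) fun i => by simp [skipShift]

theorem sum_skipShift_vecCons (G : (Fin (m + 1) → ℤ) → M) (c : ℤ) (k : Fin (m + 1) → ℤ) :
    ∑ j : Fin (m + 2), (-1 : ℤ) ^ (j : ℕ) • G (skipShift j (vecCons c k)) =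
      G (k + 1) - ∑ j : Fin (m + 1), (-1 : ℤ) ^ (j : ℕ) • G (vecCons c (skipShift j k)) := by
  rw [Fin.sum_univ_succ]
  simp [skipShift_zero_vecCons, skipShift_succ_vecCons, pow_succ, sub_eq_add_neg]

theorem sum_interlacingRows_diffProduct_one {k : Fin 2 → ℤ} (hk : StrictMono k)
    (G : (Fin 1 → ℤ) → M) :
    ∑ l ∈ interlacingRows k, shiftAction _ M (diffProduct 1) G l =
      ∑ j : Fin 2, (-1 : ℤ) ^ (j : ℕ) • G (skipShift j k) := by
  obtain ⟨c, k, rfl⟩ : ∃ c k', k = vecCons c k' := ⟨_, _, (cons_head_tail k).symm⟩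
  have hck : c ≤ k 0 := (strictMono_vecCons.1 hk).1.le
  have hk_add_one : k + 1 = ![k 0 + 1] :=
    funext fun i => by simp [Subsingleton.elim i 0]
  rw [sum_interlacingRows_vecCons, interlacingRows_eq_univ, Fintype.sum_unique,
    sum_skipShift_vecCons]
  simp only [IsEmpty.forall_iff, Finset.filter_true]
  rw [sum_Icc_shiftAction_diffProduct_vecCons G hck]
  simp [diffProduct, hk_add_one, Subsingleton.elim _ ![]]

theorem AdjacentVanishing.sum_interlacingRows_diffProduct {k : Fin (m + 1) → ℤ} (hk : StrictMono k)
    {G : (Fin m → ℤ) → M} (hG : AdjacentVanishing G) :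
    ∑ l ∈ interlacingRows k, shiftAction _ M (diffProduct m) G l =
      ∑ j : Fin (m + 1), (-1 : ℤ) ^ (j : ℕ) • G (skipShift j k) := by
  induction m using Nat.twoStepInduction with
  | zero =>
    simp [interlacingRows_eq_univ, diffProduct, Subsingleton.elim _ (skipShift 0 k)]
  | one => exact sum_interlacingRows_diffProduct_one hk G
  | more m ih ih' =>
    obtain ⟨c, k, rfl⟩ : ∃ c k', k = vecCons c k' := ⟨_, _, (cons_head_tail k).symm⟩
    obtain ⟨d, k, rfl⟩ : ∃ d k', k = vecCons d k' := ⟨_, _, (cons_head_tail k).symm⟩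
    have hcd : c ≤ d := (strictMono_vecCons.1 hk).1.le
    have hdk : StrictMono (vecCons d k) := (strictMono_vecCons.1 hk).2
    have hk_add_one : vecCons d k + 1 = vecCons (d + 1) (k + 1) :=
      funext <| Fin.cases (by simp) fun i => by simp
    have htelescope : ∑ l ∈ interlacingRows (vecCons d k), ∑ a ∈ Finset.Icc c d,
          shiftAction _ M (diffProduct (m + 2)) G (vecCons a l) =
        G (vecCons d k + 1) -
          ∑ j : Fin (m + 1), (-1 : ℤ) ^ (j : ℕ) • G (vecCons (d + 1) (vecCons d (skipShift j k))) -
          ∑ j : Fin (m + 2), (-1 : ℤ) ^ (j : ℕ) • G (vecCons c (skipShift j (vecCons d k))) := by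
      rw [Finset.sum_congr rfl fun l _ => sum_Icc_shiftAction_diffProduct_vecCons G hcd l,
        Finset.sum_sub_distrib, ih' hdk (hG.comp_vecCons _), ih' hdk (hG.comp_vecCons _),
        sum_skipShift_vecCons fun y => G (vecCons (d + 1) y), hk_add_one]
    have hcollision : ∑ l ∈ interlacingRows k,
          shiftAction _ M (diffProduct (m + 2)) G (vecCons d (vecCons d l)) =
        -∑ j : Fin (m + 1), (-1 : ℤ) ^ (j : ℕ) •
          G (vecCons (d + 1) (vecCons d (skipShift j k))) := by
      rw [Finset.sum_congr rfl fun l _ => hG.shiftAction_diffProduct_vecCons_vecCons d l,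
        Finset.sum_neg_distrib,
        ih (strictMono_vecCons.1 hdk).2 ((hG.comp_vecCons _).comp_vecCons _)]
    rw [sum_skipShift_vecCons, ← sub_left_inj, sub_right_comm, ← htelescope, sub_eq_add_neg,
      ← hcollision, sum_interlacingRows_vecCons_vecCons hdk hcd]

end Telescoping

/-! ### The recursion over interlacing rows -/

section Recursion

variable {m : ℕ} {M : Type*} [AddCommGroup M]

theorem comp_succAbove_add_sum_single (j : Fin (m + 1)) (k : Fin (m + 1) → ℤ) :
    k ∘ j.succAbove + ∑ i with j < j.succAbove i, Pi.single i 1 = skipShift j k := by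
  ext i
  rw [Pi.add_apply, Finset.sum_apply, Finset.sum_pi_single]
  by_cases h : i.castSucc < j
  · simp [skipShift, h, h.not_ge, Fin.lt_succAbove_iff_le_castSucc, Fin.succAbove_of_castSucc_lt]
  · have h' := not_lt.1 h
    simp [skipShift, h', h, Fin.lt_succAbove_iff_le_castSucc, Fin.succAbove_of_le_castSucc]

theorem shiftAction_shiftProduct_comp_succAbove (j : Fin (m + 1)) (F : (Fin m → ℤ) → M)
    (k : Fin (m + 1) → ℤ) :
    shiftAction _ M (shiftProduct (m + 1)) (fun y => F (y ∘ j.succAbove)) k =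
      shiftAction _ M (shiftProduct m) F (skipShift j k) := by
  rw [← shiftAction_reindexShifts, reindexShifts_succAbove_shiftProduct, shiftAction_mul_apply,
    shiftAction_prod_shiftVar, comp_succAbove_add_sum_single]

theorem adjacentVanishing_shiftProduct_chooseDet (s m : ℕ) :
    AdjacentVanishing (shiftAction _ ℤ (shiftProduct m) (chooseDet s m)) := by
  intro i j hij x hx
  rw [← shiftAction_mul_apply]
  refine shiftAction_eq_zero_of_antisymm (reindexShifts_swap_shiftFactor_mul_shiftProduct hij)
    (fun y => ?_) (by simp [Equiv.comp_swap_eq_update, hx])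
  rw [chooseDet_comp_perm, Equiv.Perm.sign_swap hij.ne]
  simp

theorem shiftAction_shiftProduct_chooseDet_succ {k : Fin (m + 1) → ℤ} (hk : StrictMono k) :
    shiftAction _ ℤ (shiftProduct (m + 1)) (chooseDet 0 (m + 1)) k =
      ∑ l ∈ interlacingRows k, shiftAction _ ℤ (shiftProduct m) (chooseDet 0 m) l := by
  have hdet : chooseDet 0 (m + 1) = ∑ j : Fin (m + 1),
      (-1 : ℤ) ^ (j : ℕ) • fun y => chooseDet 1 m (y ∘ j.succAbove) := by
    ext y
    simp [chooseDet_zero_succ]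
  have hdiff : shiftAction _ ℤ (diffProduct m) (shiftAction _ ℤ (shiftProduct m) (chooseDet 1 m)) =
      shiftAction _ ℤ (shiftProduct m) (chooseDet 0 m) := by
    rw [← shiftAction_mul_apply, mul_comm, shiftAction_mul_apply, diffProduct,
      shiftAction_prod_sub_one_chooseDet]
  rw [← hdiff, (adjacentVanishing_shiftProduct_chooseDet 1 m).sum_interlacingRows_diffProduct hk,
    hdet, map_sum, Finset.sum_apply]
  exact Finset.sum_congr rfl fun j _ => by
    rw [map_smul, Pi.smul_apply, shiftAction_shiftProduct_comp_succAbove]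

end Recursion

/-! ### Counting monotone triangles -/

namespace MonotoneTriangle

variable {n : ℕ}

/-- The monotone triangle without its bottom row. -/
def dropLast (T : MonotoneTriangle (n + 1)) : MonotoneTriangle n where
  entry i j := T.entry i.castSucc j
  row_lt i j := T.row_lt i.castSucc j
  northeast i h j := T.northeast i (h.trans n.lt_succ_self) j
  southeast i h j := T.southeast i (h.trans n.lt_succ_self) j

/-- The rows of `T` followed by the row `k`. -/
def snocEntry (T : MonotoneTriangle n) (k : Fin (n + 1) → ℤ) :
    (i : Fin (n + 1)) → Fin ((i : ℕ) + 1) → ℤ :=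
  Fin.snoc (α := fun i => Fin ((i : ℕ) + 1) → ℤ) T.entry k

theorem snocEntry_of_lt (T : MonotoneTriangle n) (k : Fin (n + 1) → ℤ) {i : ℕ} (hi : i < n) :
    T.snocEntry k ⟨i, hi.trans n.lt_succ_self⟩ = T.entry ⟨i, hi⟩ :=
  Fin.snoc_castSucc (α := fun i => Fin ((i : ℕ) + 1) → ℤ) k T.entry ⟨i, hi⟩

theorem snocEntry_last (T : MonotoneTriangle n) (k : Fin (n + 1) → ℤ) :
    T.snocEntry k (Fin.last n) = k :=
  Fin.snoc_last (α := fun i => Fin ((i : ℕ) + 1) → ℤ) k T.entry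

theorem snocEntry_interlacing {T : MonotoneTriangle n} {l : Fin n → ℤ}
    (hT : T ∈ monotoneTriangles n l) {k : Fin (n + 1) → ℤ} (hl : l ∈ interlacingRows k) {i : ℕ}
    (h : i + 1 < n + 1) (j : Fin (i + 1)) :
    T.snocEntry k ⟨i + 1, h⟩ j.castSucc ≤ T.snocEntry k ⟨i, Nat.lt_of_succ_lt h⟩ j ∧
      T.snocEntry k ⟨i, Nat.lt_of_succ_lt h⟩ j ≤ T.snocEntry k ⟨i + 1, h⟩ j.succ := by
  rw [snocEntry_of_lt T k (Nat.lt_of_succ_lt_succ h)]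
  obtain hi | rfl : i + 1 < n ∨ n = i + 1 := by lia
  · rw [snocEntry_of_lt T k hi]
    exact ⟨T.northeast i hi j, T.southeast i hi j⟩
  · have hrow : T.entry ⟨i, Nat.lt_of_succ_lt_succ h⟩ j = l j := hT (Fin.last i) rfl j
    have hlast : T.snocEntry k ⟨i + 1, h⟩ = k := T.snocEntry_last k
    rw [hlast, hrow]
    exact (mem_interlacingRows.1 hl).1 j

/-- The monotone triangle `T` with the additional bottom row `k`. -/
def snoc (T : MonotoneTriangle n) {l : Fin n → ℤ} (hT : T ∈ monotoneTriangles n l)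
    {k : Fin (n + 1) → ℤ} (hk : StrictMono k) (hl : l ∈ interlacingRows k) :
    MonotoneTriangle (n + 1) where
  entry := T.snocEntry k
  row_lt := Fin.lastCases (fun j => by
    simpa only [T.snocEntry_last k] using hk j.castSucc_lt_succ) fun i j => by
    have hi : T.snocEntry k i.castSucc = T.entry i := T.snocEntry_of_lt k i.isLt
    simpa only [hi] using T.row_lt i j
  northeast _ h j := (snocEntry_interlacing hT hl h j).1
  southeast _ h j := (snocEntry_interlacing hT hl h j).2

theorem snoc_mem (T : MonotoneTriangle n) {l : Fin n → ℤ} (hT : T ∈ monotoneTriangles n l)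
    {k : Fin (n + 1) → ℤ} (hk : StrictMono k) (hl : l ∈ interlacingRows k) :
    T.snoc hT hk hl ∈ monotoneTriangles (n + 1) k := by
  intro i h j
  obtain rfl : i = Fin.last n := Fin.ext (Nat.succ_injective h)
  exact congrFun (T.snocEntry_last k) j

theorem dropLast_snoc (T : MonotoneTriangle n) {l : Fin n → ℤ} (hT : T ∈ monotoneTriangles n l)
    {k : Fin (n + 1) → ℤ} (hk : StrictMono k) (hl : l ∈ interlacingRows k) :
    (T.snoc hT hk hl).dropLast = T := by
  ext i j
  exact congrFun (T.snocEntry_of_lt k i.isLt) j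

theorem exists_mem_monotoneTriangles : ∀ {n : ℕ} (T : MonotoneTriangle n),
    ∃ l, T ∈ monotoneTriangles n l
  | 0, _ => ⟨![], fun i => i.elim0⟩
  | n + 1, T => ⟨T.entry (Fin.last n), fun i h j => by
      obtain rfl : i = Fin.last n := Fin.ext (Nat.succ_injective h)
      rfl⟩

theorem eq_of_mem_monotoneTriangles : ∀ {n : ℕ} {T : MonotoneTriangle n} {l l' : Fin n → ℤ},
    T ∈ monotoneTriangles n l → T ∈ monotoneTriangles n l' → l = l'
  | 0, _, _, _, _, _ => Subsingleton.elim _ _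
  | n + 1, _, _, _, h, h' => funext fun j =>
      (h (Fin.last n) rfl j).symm.trans (h' (Fin.last n) rfl j)

theorem mem_interlacingRows_of_dropLast_mem {T : MonotoneTriangle (n + 1)} {k : Fin (n + 1) → ℤ}
    (hT : T ∈ monotoneTriangles (n + 1) k) {l : Fin n → ℤ}
    (hl : T.dropLast ∈ monotoneTriangles n l) : l ∈ interlacingRows k := by
  obtain _ | n := n
  · exact interlacingRows_eq_univ k ▸ Finset.mem_univ l
  · obtain rfl : T.entry (Fin.last n).castSucc = l := funext fun j => hl (Fin.last n) rfl j
    obtain rfl : T.entry (Fin.last (n + 1)) = k := funext fun j => hT (Fin.last (n + 1)) rfl j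
    exact mem_interlacingRows.2
      ⟨fun j => ⟨T.northeast n (Nat.lt_succ_self _) j, T.southeast n (Nat.lt_succ_self _) j⟩,
        Fin.strictMono_iff_lt_succ.2 (T.row_lt (Fin.last n).castSucc)⟩

theorem injOn_dropLast (k : Fin (n + 1) → ℤ) :
    Set.InjOn dropLast (monotoneTriangles (n + 1) k) := by
  intro T hT T' hT' h
  ext i j
  induction i using Fin.lastCases with
  | last => exact (hT (Fin.last n) rfl j).trans (hT' (Fin.last n) rfl j).symm
  | cast i => exact congrFun (congrFun (congrArg entry h) i) j

theorem image_dropLast_subset (k : Fin (n + 1) → ℤ) :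
    dropLast '' monotoneTriangles (n + 1) k ⊆ ⋃ l ∈ interlacingRows k, monotoneTriangles n l := by
  rintro _ ⟨T, hT, rfl⟩
  obtain ⟨l, hl⟩ := T.dropLast.exists_mem_monotoneTriangles
  exact Set.mem_biUnion (mem_interlacingRows_of_dropLast_mem hT hl) hl

theorem image_dropLast {k : Fin (n + 1) → ℤ} (hk : StrictMono k) :
    dropLast '' monotoneTriangles (n + 1) k = ⋃ l ∈ interlacingRows k, monotoneTriangles n l := by
  refine (image_dropLast_subset k).antisymm (Set.iUnion₂_subset fun l hl T hT => ?_)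
  exact ⟨T.snoc hT hk hl, T.snoc_mem hT hk hl, T.dropLast_snoc hT hk hl⟩

end MonotoneTriangle

open MonotoneTriangle

theorem finite_monotoneTriangles : ∀ (n : ℕ) (k : Fin n → ℤ), (monotoneTriangles n k).Finite
  | 0, _ => Set.Subsingleton.finite fun _ _ _ _ => MonotoneTriangle.ext (Subsingleton.elim _ _)
  | n + 1, k => Set.Finite.of_finite_image
      (((interlacingRows k).finite_toSet.biUnion fun l _ => finite_monotoneTriangles n l).subset
        (image_dropLast_subset k)) (injOn_dropLast k)

theorem ncard_monotoneTriangles_zero (k : Fin 0 → ℤ) : (monotoneTriangles 0 k).ncard = 1 := by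
  rw [Set.ncard_eq_one]
  refine ⟨⟨fun i => i.elim0, fun i => i.elim0, fun _ h => absurd h (Nat.not_lt_zero _),
    fun _ h => absurd h (Nat.not_lt_zero _)⟩, Set.eq_singleton_iff_unique_mem.2
      ⟨fun i => i.elim0, fun _ _ => MonotoneTriangle.ext (Subsingleton.elim _ _)⟩⟩

theorem ncard_monotoneTriangles_succ {n : ℕ} {k : Fin (n + 1) → ℤ} (hk : StrictMono k) :
    (monotoneTriangles (n + 1) k).ncard =
      ∑ l ∈ interlacingRows k, (monotoneTriangles n l).ncard := by
  have hcard := (interlacingRows k).finite_toSet.ncard_biUnion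
    (fun l _ => finite_monotoneTriangles n l) fun l _ l' _ hne =>
      Set.disjoint_left.2 fun _ hT hT' => hne (eq_of_mem_monotoneTriangles hT hT')
  simp only [Finset.mem_coe] at hcard
  rw [← (injOn_dropLast k).ncard_image, image_dropLast hk, hcard, finsum_mem_finset_eq_sum]

theorem ncard_monotoneTriangles {n : ℕ} {k : Fin n → ℤ} (hk : StrictMono k) :
    ((monotoneTriangles n k).ncard : ℤ) =
      shiftAction _ ℤ (shiftProduct n) (chooseDet 0 n) k := by
  induction n with
  | zero => simp [ncard_monotoneTriangles_zero, shiftProduct, indexPairs, chooseDet]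
  | succ n ih =>
    rw [ncard_monotoneTriangles_succ hk, shiftAction_shiftProduct_chooseDet_succ hk, Nat.cast_sum]
    exact Finset.sum_congr rfl fun l hl => ih (mem_interlacingRows.1 hl).2

theorem theorem1 (n : ℕ) (k : Fin n → ℤ) (hk : StrictMono k) :
    (monotoneTriangles n k).Finite ∧
      ((monotoneTriangles n k).ncard : ℚ) =
        MvPolynomial.eval (fun i => (k i : ℚ)) (productOp n (vandermondeQuotient n)) := by
  refine ⟨finite_monotoneTriangles n k, ?_⟩
  rw [eval_productOp_vandermondeQuotient, ← ncard_monotoneTriangles hk, Int.cast_natCast]
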